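/- Let $K$ be an algebraically closed field and $m,n\ge 0$. Let $I\subset K[t_0,\dots,t_m]$ be a homogeneous prime ideal such that $X=V(I)\subset\mathbb P^m_K$ is an irreducible (in particular non-empty) projective variety, let $Y=V(Q)\subset\mathbb P^n_K$ be an irreducible projective variety given by a homogeneous ideal $Q\subset K[x_0,\dots,x_n]$, and let $f_0,\dots,f_n\in K[t_0,\dots,t_m]$ be forms of the same degree which do not all vanish identically on $X$ and such that $(f_0(t):\dots:f_n(t))\in Y$ for all $t\in X\setminus V(f_0,\dots,f_n)$. Let $$\Phi: X\dashrightarrow Y,\qquad t\mapsto (f_0(t):\dots:f_n(t))$$ be the rational map they define, that is, the class of all morphisms from non-empty open subsets of $X$ to $Y$ that agree with $t\mapsto (f_0(t):\dots:f_n(t))$ wherever both are defined. Let $D(\Phi)\subset X$ be its domain of definition, the largest open set on which a morphism in the class is defined (it contains $X\setminus V(f_0,\dots,f_n)$ and may be larger), and let $$\Gamma(\Phi)=\{(t,x)\mid t\in D(\Phi),\ x=\Phi(t)\}\subset\mathbb P^m_K\times\mathbb P^n_K$$ be its graph. Then the closure of the graph in the Zariski topology of $\mathbb P^m_K\times\mathbb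 P^n_K$ is $$\overline{\Gamma(\Phi)}=V\bigl((I+J):\langle f_0,\dots,f_n\rangle^\infty\bigr),$$ where all ideals are taken in $K[t_0,\dots,t_m,x_0,\dots,x_n]$ ($I$ standing for the ideal it generates there), $J$ is generated by the $2\times 2$ minors of the matrix $$\begin{pmatrix}x_0&\cdots&x_n\\ f_0&\cdots&f_n\end{pmatrix},$$ $A:B^\infty=\{h\mid \exists N\in\mathbb N\ \forall g\in B:\ hg^N\in A\}$ is the saturation, and $V(A)\subset\mathbb P^m_K\times\mathbb P^n_K$ denotes the set of common zeros of the bihomogeneous polynomials in $A$. -/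

import Mathlib

open MvPolynomial Topology

namespace RatMap

/-- The projective space `ℙ^n` over `K`, with homogeneous coordinates `x_0, …, x_n`. -/
abbrev Proj (K : Type*) [Field K] (n : ℕ) : Type _ := Projectivization K (Fin (n + 1) → K)

section Zariski

variable {K : Type*} [Field K] {m n : ℕ}

/-- The value of a form scales by a nonzero factor if another homogeneous coordinate vector is
used; so whether a form vanishes at `t`, and the quotient of two forms of equal degree at `t`, can
be computed with the chosen coordinate vector `t.rep`. -/
theorem eval_smul {σ : Type*} {p : MvPolynomial σ K} {d : ℕ} (hp : p.IsHomogeneous d) (c : K)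
    (v : σ → K) : eval (c • v) p = c ^ d * eval v p := by
  rw [eval_eq, eval_eq, Finset.mul_sum]
  refine Finset.sum_congr rfl fun s hs => ?_
  have hd : s.degree = d := by
    by_contra h
    exact (mem_support_iff.mp hs) (hp.coeff_eq_zero h)
  have h1 : (∏ i ∈ s.support, (c • v) i ^ s i) = c ^ d * ∏ i ∈ s.support, v i ^ s i := by
    simp only [Pi.smul_apply, smul_eq_mul, mul_pow, Finset.prod_mul_distrib]
    rw [Finset.prod_pow_eq_pow_sum, ← hd]
    rfl
  rw [h1]
  ring

/-- The projective vanishing locus `V(S) ⊆ ℙ^n`: the common zeros of the forms in `S`. -/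
def zeroLocus (S : Set (MvPolynomial (Fin (n + 1)) K)) : Set (Proj K n) :=
  {t | ∀ p ∈ S, ∀ d : ℕ, p.IsHomogeneous d → eval t.rep p = 0}

/-- The Zariski topology on `ℙ^n`: the closed sets are the projective vanishing loci. -/
instance zariski (K : Type*) [Field K] (n : ℕ) : TopologicalSpace (Proj K n) :=
  TopologicalSpace.ofClosed
    {Z | ∃ S : Set (MvPolynomial (Fin (n + 1)) K), Z = zeroLocus S}
    (by
      refine ⟨{1}, Set.eq_empty_of_forall_notMem ?_ |>.symm⟩
      intro t ht
      simpa using ht 1 rfl 0 (isHomogeneous_one _ _))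
    (by
      intro A hA
      refine ⟨{p | ∃ S, zeroLocus S ∈ A ∧ p ∈ S}, Set.ext fun t => ⟨?_, ?_⟩⟩
      · rintro ht p ⟨S, hS, hp⟩ d hd
        exact ht _ hS p hp d hd
      · intro ht Z hZ
        obtain ⟨S, rfl⟩ := hA hZ
        exact fun p hp d hd => ht p ⟨S, hZ, hp⟩ d hd)
    (by
      rintro _ ⟨S, rfl⟩ _ ⟨T, rfl⟩
      refine ⟨{r | ∃ p ∈ S, ∃ q ∈ T, (∃ d, p.IsHomogeneous d) ∧ (∃ e, q.IsHomogeneous e) ∧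
        r = p * q}, Set.ext fun t => ⟨?_, ?_⟩⟩
      · rintro (ht | ht) _ ⟨p, hp, q, hq, ⟨d, hd⟩, ⟨e, he⟩, rfl⟩ _ _
        · simp [ht p hp d hd]
        · simp [ht q hq e he]
      · intro ht
        by_contra hcon
        simp only [Set.mem_union, not_or, zeroLocus, Set.mem_ofPred_eq, not_forall] at hcon
        obtain ⟨⟨p, hp, d, hd, hp0⟩, ⟨q, hq, e, he, hq0⟩⟩ := hcon
        have := ht (p * q) ⟨p, hp, q, hq, ⟨d, hd⟩, ⟨e, he⟩, rfl⟩ _ (hd.mul he)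
        rw [map_mul] at this
        exact (mul_ne_zero hp0 hq0) this)

/-- `p ∈ K[t_0, …, t_m, x_0, …, x_n]` is bihomogeneous of bidegree `ab`: homogeneous of degree
`ab.1` in the variables `t` and of degree `ab.2` in the variables `x`. -/
def IsBihomogeneous (p : MvPolynomial (Fin (m + 1) ⊕ Fin (n + 1)) K) (ab : ℕ × ℕ) : Prop :=
  IsWeightedHomogeneous (Sum.elim (fun _ => ((1, 0) : ℕ × ℕ)) (fun _ => ((0, 1) : ℕ × ℕ))) p ab

/-- The vanishing locus `V(S) ⊆ ℙ^m × ℙ^n`: the common zeros of the bihomogeneous polynomials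
in `S`. -/
def biZeroLocus (S : Set (MvPolynomial (Fin (m + 1) ⊕ Fin (n + 1)) K)) :
    Set (Proj K m × Proj K n) :=
  {z | ∀ p ∈ S, ∀ ab : ℕ × ℕ, IsBihomogeneous p ab → eval (Sum.elim z.1.rep z.2.rep) p = 0}

/-- The Zariski topology on `ℙ^m × ℙ^n`: the closed sets are the vanishing loci of sets of
bihomogeneous polynomials. (This is not the product topology, so it is not an instance.) -/
@[reducible]
def zariskiProd (K : Type*) [Field K] (m n : ℕ) : TopologicalSpace (Proj K m × Proj K n) :=
  TopologicalSpace.ofClosed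
    {Z | ∃ S : Set (MvPolynomial (Fin (m + 1) ⊕ Fin (n + 1)) K), Z = biZeroLocus S}
    (by
      refine ⟨{1}, Set.eq_empty_of_forall_notMem ?_ |>.symm⟩
      intro t ht
      simpa using ht 1 rfl 0 (isWeightedHomogeneous_one _ _))
    (by
      intro A hA
      refine ⟨{p | ∃ S, biZeroLocus S ∈ A ∧ p ∈ S}, Set.ext fun t => ⟨?_, ?_⟩⟩
      · rintro ht p ⟨S, hS, hp⟩ d hd
        exact ht _ hS p hp d hd
      · intro ht Z hZ
        obtain ⟨S, rfl⟩ := hA hZ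
        exact fun p hp d hd => ht p ⟨S, hZ, hp⟩ d hd)
    (by
      rintro _ ⟨S, rfl⟩ _ ⟨T, rfl⟩
      refine ⟨{r | ∃ p ∈ S, ∃ q ∈ T, (∃ d, IsBihomogeneous p d) ∧ (∃ e, IsBihomogeneous q e) ∧
        r = p * q}, Set.ext fun t => ⟨?_, ?_⟩⟩
      · rintro (ht | ht) _ ⟨p, hp, q, hq, ⟨d, hd⟩, ⟨e, he⟩, rfl⟩ _ _
        · simp [ht p hp d hd]
        · simp [ht q hq e he]
      · intro ht
        by_contra hcon
        simp only [Set.mem_union, not_or, biZeroLocus, Set.mem_ofPred_eq, not_forall] at hcon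
        obtain ⟨⟨p, hp, d, hd, hp0⟩, ⟨q, hq, e, he, hq0⟩⟩ := hcon
        have := ht (p * q) ⟨p, hp, q, hq, ⟨d, hd⟩, ⟨e, he⟩, rfl⟩ _
          (IsWeightedHomogeneous.mul hd he)
        rw [map_mul] at this
        exact (mul_ne_zero hp0 hq0) this)

theorem isClosed_zeroLocus (S : Set (MvPolynomial (Fin (n + 1)) K)) :
    IsClosed (zeroLocus S) := by
  rw [← isOpen_compl_iff]
  exact ⟨S, compl_compl _⟩

theorem isClosed_iff_zeroLocus {Z : Set (Proj K n)} :
    IsClosed Z ↔ ∃ S : Set (MvPolynomial (Fin (n + 1)) K), Z = zeroLocus S := by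
  refine ⟨fun h => ?_, fun ⟨S, h⟩ => h ▸ isClosed_zeroLocus S⟩
  obtain ⟨S, hS⟩ := isOpen_compl_iff.mpr h
  exact ⟨S, by rw [← hS, compl_compl]⟩

end Zariski

section Morphisms

variable {K : Type*} [Field K] {m n : ℕ}

/-- `φ` restricts to a regular function on `U ⊆ ℙ^m`: near every point of `U` it is a quotient of
two forms of the same degree. (Values of `φ` outside `U` are irrelevant.) -/
def IsRegularOn (U : Set (Proj K m)) (φ : Proj K m → K) : Prop :=
  ∀ p ∈ U, ∃ W : Set (Proj K m), IsOpen W ∧ p ∈ W ∧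
    ∃ (d : ℕ) (g h : MvPolynomial (Fin (m + 1)) K), g.IsHomogeneous d ∧ h.IsHomogeneous d ∧
      ∀ q ∈ U ∩ W, eval q.rep h ≠ 0 ∧ φ q = eval q.rep g / eval q.rep h

/-- `F` restricts to a morphism of quasi-projective varieties `U → Y`: it maps `U` into `Y`, is
continuous on `U`, and pulls regular functions on open subsets `Y ∩ V` of `Y` back to regular
functions. (Values of `F` outside `U` are irrelevant.) -/
structure IsMorphismOn (U : Set (Proj K m)) (Y : Set (Proj K n)) (F : Proj K m → Proj K n) :
    Prop where
  mapsTo : Set.MapsTo F U Y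
  continuousOn : ContinuousOn F U
  regular_comp : ∀ V : Set (Proj K n), IsOpen V → ∀ φ : Proj K n → K,
    IsRegularOn (Y ∩ V) φ → IsRegularOn (U ∩ F ⁻¹' (Y ∩ V)) (φ ∘ F)

/-- A morphism to `Y` from a non-empty open subset of `X`. -/
structure PartialMorphism (X : Set (Proj K m)) (Y : Set (Proj K n)) where
  dom : Set (Proj K m)
  exists_open : ∃ W : Set (Proj K m), IsOpen W ∧ dom = X ∩ W
  nonempty : dom.Nonempty
  toFun : Proj K m → Proj K n
  isMorphism : IsMorphismOn dom Y toFun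

/-- Two morphisms from non-empty open subsets of `X` are equivalent if they agree on the
intersection of their domains. -/
def PartialMorphism.Equivalent {X : Set (Proj K m)} {Y : Set (Proj K n)}
    (r s : PartialMorphism X Y) : Prop :=
  ∀ t ∈ r.dom ∩ s.dom, r.toFun t = s.toFun t

/-- A rational map `X ⇢ Y`: an equivalence class of morphisms from non-empty open subsets of `X`
to `Y`. -/
structure RationalMap (X : Set (Proj K m)) (Y : Set (Proj K n)) where
  reps : Set (PartialMorphism X Y)
  isClass : ∃ r : PartialMorphism X Y, reps = {s | r.Equivalent s}

/-- The domain of definition `D(Φ)`: the largest open subset of `X` on which `Φ` is defined, that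
is, the union of the domains of all representatives. -/
def RationalMap.domain {X : Set (Proj K m)} {Y : Set (Proj K n)} (Φ : RationalMap X Y) :
    Set (Proj K m) :=
  {t | ∃ s ∈ Φ.reps, t ∈ s.dom}

/-- The graph `Γ(Φ) = {(t, x) | t ∈ D(Φ), x = Φ(t)}`, where `Φ(t)` is the value at `t` of a
representative defined at `t`. -/
def RationalMap.graph {X : Set (Proj K m)} {Y : Set (Proj K n)} (Φ : RationalMap X Y) :
    Set (Proj K m × Proj K n) :=
  {z | z.1 ∈ Φ.domain ∧ ∃ s ∈ Φ.reps, z.1 ∈ s.dom ∧ z.2 = s.toFun z.1}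

/-- The point `(f_0(t) : … : f_n(t))`, if some `f_i(t)` is nonzero (else a junk value). -/
noncomputable def polyMap (f : Fin (n + 1) → MvPolynomial (Fin (m + 1)) K) (t : Proj K m) :
    Proj K n :=
  open Classical in
  if h : (fun i => eval t.rep (f i)) ≠ 0 then Projectivization.mk K _ h
  else Projectivization.mk K (fun _ => 1) (fun h => one_ne_zero (congrFun h 0))

theorem ne_zero_of_notMem {f : Fin (n + 1) → MvPolynomial (Fin (m + 1)) K}
    {t : Proj K m} (ht : t ∉ zeroLocus (Set.range f)) :
    (fun i => eval t.rep (f i)) ≠ 0 := by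
  intro h
  apply ht
  rintro _ ⟨i, rfl⟩ _ _
  exact congrFun h i

theorem eval_polyMap {f : Fin (n + 1) → MvPolynomial (Fin (m + 1)) K}
    {t : Proj K m} (ht : t ∉ zeroLocus (Set.range f)) :
    ∃ c : K, c ≠ 0 ∧ ∀ (p : MvPolynomial (Fin (n + 1)) K) (e : ℕ), p.IsHomogeneous e →
      eval (polyMap f t).rep p = c ^ e * eval t.rep (aeval f p) := by
  have h := ne_zero_of_notMem ht
  obtain ⟨a, ha⟩ := Projectivization.exists_smul_eq_mk_rep K _ h
  refine ⟨a, a.ne_zero, fun p e hp => ?_⟩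
  have h1 : (polyMap f t).rep = (a : K) • fun i => eval t.rep (f i) := by
    rw [polyMap, dif_pos h, ← ha]
    rfl
  rw [h1, eval_smul hp]
  congr 1
  have h2 : (eval t.rep).comp (aeval f).toRingHom = eval fun i => eval t.rep (f i) := by
    apply MvPolynomial.ringHom_ext <;> intro i <;> simp
  exact (DFunLike.congr_fun h2 p).symm

/-- Forms of the same degree define a morphism away from their common zeros. -/
theorem isMorphismOn_polyMap {f : Fin (n + 1) → MvPolynomial (Fin (m + 1)) K} {d : ℕ}
    (hf : ∀ i, (f i).IsHomogeneous d) {X : Set (Proj K m)} {Y : Set (Proj K n)}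
    (hY : ∀ t ∈ X, t ∉ zeroLocus (Set.range f) → polyMap f t ∈ Y) :
    IsMorphismOn (X ∩ (zeroLocus (Set.range f))ᶜ) Y (polyMap f) := by
  have hcont : ContinuousOn (polyMap f) (X ∩ (zeroLocus (Set.range f))ᶜ) := by
    rw [continuousOn_iff_isClosed]
    intro Z hZ
    obtain ⟨S, rfl⟩ := isClosed_iff_zeroLocus.mp hZ
    refine ⟨zeroLocus {q | ∃ p ∈ S, (∃ e, p.IsHomogeneous e) ∧ q = aeval f p},
      isClosed_zeroLocus _, Set.ext fun t => and_congr_left fun ht => ?_⟩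
    obtain ⟨c, hc, hev⟩ := eval_polyMap ht.2
    constructor
    · rintro h _ ⟨p, hp, ⟨e, he⟩, rfl⟩ _ _
      have := h p hp e he
      rw [hev p e he] at this
      exact (mul_eq_zero.mp this).resolve_left (pow_ne_zero _ hc)
    · intro h p hp e he
      rw [hev p e he, h _ ⟨p, hp, ⟨e, he⟩, rfl⟩ _ (he.aeval f hf), mul_zero]
  refine ⟨fun t ht => hY t ht.1 ht.2, hcont, ?_⟩
  rintro V - φ hφ t ⟨htU, htV⟩
  obtain ⟨W, hW, htW, e, g, h, hg, hh, hq⟩ := hφ _ htV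
  obtain ⟨W', hW', hWW'⟩ := (continuousOn_iff'.mp hcont) W hW
  refine ⟨W', hW', ?_, d * e, aeval f g, aeval f h, hg.aeval f hf, hh.aeval f hf, ?_⟩
  · have : t ∈ polyMap f ⁻¹' W ∩ (X ∩ (zeroLocus (Set.range f))ᶜ) := ⟨htW, htU⟩
    rw [hWW'] at this
    exact this.1
  · rintro q ⟨⟨hqU, hqV⟩, hqW'⟩
    have hqW : q ∈ polyMap f ⁻¹' W ∩ (X ∩ (zeroLocus (Set.range f))ᶜ) := by
      rw [hWW']; exact ⟨hqW', hqU⟩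
    obtain ⟨h1, h2⟩ := hq (polyMap f q) ⟨hqV, hqW.1⟩
    obtain ⟨c, hc, hev⟩ := eval_polyMap hqU.2
    rw [hev g e hg, hev h e hh] at h2
    rw [hev h e hh] at h1
    refine ⟨right_ne_zero_of_mul h1, ?_⟩
    rw [Function.comp_apply, h2, mul_div_mul_left _ _ (pow_ne_zero _ hc)]

/-- The morphism `X \ V(f_0, …, f_n) → Y`, `t ↦ (f_0(t) : … : f_n(t))`, for forms `f_i` of the same
degree that do not all vanish on all of `X`. -/
noncomputable def PartialMorphism.ofForms (X : Set (Proj K m)) (Y : Set (Proj K n))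
    (f : Fin (n + 1) → MvPolynomial (Fin (m + 1)) K) (d : ℕ) (hf : ∀ i, (f i).IsHomogeneous d)
    (hne : (X ∩ (zeroLocus (Set.range f))ᶜ).Nonempty)
    (hY : ∀ t ∈ X, t ∉ zeroLocus (Set.range f) → polyMap f t ∈ Y) : PartialMorphism X Y where
  dom := X ∩ (zeroLocus (Set.range f))ᶜ
  exists_open := ⟨_, (isClosed_zeroLocus _).isOpen_compl, rfl⟩
  nonempty := hne
  toFun := polyMap f
  isMorphism := isMorphismOn_polyMap hf hY

/-- The rational map `X ⇢ Y`, `t ↦ (f_0(t) : … : f_n(t))`. -/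
noncomputable def RationalMap.ofForms (X : Set (Proj K m)) (Y : Set (Proj K n))
    (f : Fin (n + 1) → MvPolynomial (Fin (m + 1)) K) (d : ℕ) (hf : ∀ i, (f i).IsHomogeneous d)
    (hne : (X ∩ (zeroLocus (Set.range f))ᶜ).Nonempty)
    (hY : ∀ t ∈ X, t ∉ zeroLocus (Set.range f) → polyMap f t ∈ Y) : RationalMap X Y where
  reps := {s | (PartialMorphism.ofForms X Y f d hf hne hY).Equivalent s}
  isClass := ⟨_, rfl⟩

end Morphisms

section Ideals

attribute [local instance] MvPolynomial.gradedAlgebra in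
/-- `I ⊆ K[t_0, …, t_m]` is a homogeneous ideal for the grading by degree. -/
def IsHomogeneousIdeal {K : Type*} [Field K] {m : ℕ} (I : Ideal (MvPolynomial (Fin (m + 1)) K)) :
    Prop :=
  I.IsHomogeneous (homogeneousSubmodule (Fin (m + 1)) K)

/-- The saturation `I : J^∞ = {f | ∃ N, ∀ g ∈ J, f * g ^ N ∈ I}`. -/
def saturation {R : Type*} [CommRing R] (I J : Ideal R) : Ideal R where
  carrier := {f | ∃ N : ℕ, ∀ g ∈ J, f * g ^ N ∈ I}
  zero_mem' := ⟨0, fun g _ => by simp⟩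
  add_mem' := by
    rintro a b ⟨N, hN⟩ ⟨M, hM⟩
    refine ⟨N + M, fun g hg => ?_⟩
    have h : (a + b) * g ^ (N + M) = a * g ^ N * g ^ M + b * g ^ M * g ^ N := by ring
    rw [h]
    exact I.add_mem (I.mul_mem_right _ (hN g hg)) (I.mul_mem_right _ (hM g hg))
  smul_mem' := by
    rintro c a ⟨N, hN⟩
    refine ⟨N, fun g hg => ?_⟩
    rw [smul_eq_mul, mul_assoc]
    exact I.mul_mem_left _ (hN g hg)

/-- The ideal generated by the `2 × 2` minors of a matrix with two rows. (Repeating or exchanging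
columns gives zero or changes the sign, so the columns need not be increasing.) -/
def minors₂ {R : Type*} [CommRing R] {ι : Type*} (A : Matrix (Fin 2) ι R) : Ideal R :=
  Ideal.span (Set.range fun c : Fin 2 → ι => (A.submatrix id c).det)

variable {K : Type*} [Field K] {m n : ℕ}

/-- The inclusion `K[t_0, …, t_m] → K[t_0, …, t_m, x_0, …, x_n]`. -/
noncomputable def inclT (K : Type*) [Field K] (m n : ℕ) :
    MvPolynomial (Fin (m + 1)) K →ₐ[K] MvPolynomial (Fin (m + 1) ⊕ Fin (n + 1)) K :=
  rename Sum.inl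

/-- The matrix with rows `(x_0 … x_n)` and `(f_0 … f_n)`. -/
noncomputable def graphMatrix (f : Fin (n + 1) → MvPolynomial (Fin (m + 1)) K) :
    Matrix (Fin 2) (Fin (n + 1)) (MvPolynomial (Fin (m + 1) ⊕ Fin (n + 1)) K) :=
  Matrix.of ![fun j => X (Sum.inr j), fun j => inclT K m n (f j)]

/-- The ideal `(I + J) : ⟨f_0, …, f_n⟩^∞` of `K[t_0, …, t_m, x_0, …, x_n]`, where `J` is generated
by the `2 × 2` minors of the matrix with rows `(x_0 … x_n)` and `(f_0 … f_n)`. -/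
noncomputable def graphIdeal (I : Ideal (MvPolynomial (Fin (m + 1)) K))
    (f : Fin (n + 1) → MvPolynomial (Fin (m + 1)) K) :
    Ideal (MvPolynomial (Fin (m + 1) ⊕ Fin (n + 1)) K) :=
  saturation (I.map (inclT K m n) + minors₂ (graphMatrix f))
    (Ideal.span (Set.range fun i => inclT K m n (f i)))

end Ideals

end RatMap

namespace RatMap

/-! Both sides are closed, so it suffices to compare the bihomogeneous polynomials `p` that vanish
on the graph with those in the saturation. Let `b` be the degree of `p` in the `x`-variables.

Modulo the minors `f_i x_k = x_i f_k`, hence `f_i ^ b * p(t, x) ≡ x_i ^ b * p(t, f(t))`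
(`pow_mul_sub_mem_minors`). If `p` vanishes on the graph off `V(f)`, then `p(t, f(t)) * f_i`
vanishes on all of `X` and lies in `I` by the Nullstellensatz, so `p * f_i ^ (b + 1) ∈ I + J` for
every `i` (`mem_graphIdeal`). Conversely, `I + J` vanishes at the graph points off `V(f)`, and some
`f_i` is nonzero there, so the saturation vanishes too (`graphIdeal_eval_eq_zero`).

The domain of definition may exceed `X \ V(f)`. Every representative is locally given by forms
(`PartialMorphism.exists_forms`), so irreducibility of `X` carries the vanishing of `p` to the whole
graph (`PartialMorphism.eval_eq_zero_of_agree`). -/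

theorem eval_eq_zero_of_mem_zeroLocus {K : Type*} [Field K] {m : ℕ}
    {I : Ideal (MvPolynomial (Fin (m + 1)) K)} (hI : IsHomogeneousIdeal I) {t : Proj K m}
    (ht : t ∈ zeroLocus (I : Set (MvPolynomial (Fin (m + 1)) K)))
    {p : MvPolynomial (Fin (m + 1)) K} (hp : p ∈ I) : eval t.rep p = 0 := by
  rw [← sum_homogeneousComponent p, map_sum]
  exact Finset.sum_eq_zero fun i _ =>
    ht _ (homogeneousComponent_mem_of_mem hI hp i) i (homogeneousComponent_isHomogeneous i p)

section

variable {K : Type*} [Field K] {m n : ℕ}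

theorem mem_zeroLocus_singleton {p : MvPolynomial (Fin (m + 1)) K} {d : ℕ}
    (hp : p.IsHomogeneous d) {t : Proj K m} : t ∈ zeroLocus {p} ↔ eval t.rep p = 0 := by
  refine ⟨fun h => h p rfl d hp, ?_⟩
  rintro h _ rfl _ _
  exact h

/-! ### Bihomogeneous polynomials and their zero loci -/

theorem isClosed_biZeroLocus (S : Set (MvPolynomial (Fin (m + 1) ⊕ Fin (n + 1)) K)) :
    IsClosed[zariskiProd K m n] (biZeroLocus S) := by
  rw [← @isOpen_compl_iff _ _ (zariskiProd K m n)]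
  exact ⟨S, compl_compl _⟩

theorem isClosed_iff_biZeroLocus {Z : Set (Proj K m × Proj K n)} :
    IsClosed[zariskiProd K m n] Z ↔
      ∃ S : Set (MvPolynomial (Fin (m + 1) ⊕ Fin (n + 1)) K), Z = biZeroLocus S := by
  refine ⟨fun h => ?_, fun ⟨S, h⟩ => h ▸ isClosed_biZeroLocus S⟩
  obtain ⟨S, hS⟩ := (@isOpen_compl_iff _ _ (zariskiProd K m n)).mpr h
  exact ⟨S, by rw [← hS, compl_compl]⟩

theorem IsBihomogeneous.sum_eq {p : MvPolynomial (Fin (m + 1) ⊕ Fin (n + 1)) K} {ab : ℕ × ℕ}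
    (hp : IsBihomogeneous p ab) {s : (Fin (m + 1) ⊕ Fin (n + 1)) →₀ ℕ} (hs : s ∈ p.support) :
    ∑ i, s (Sum.inl i) = ab.1 ∧ ∑ j, s (Sum.inr j) = ab.2 := by
  have h := hp (mem_support_iff.mp hs)
  rw [Finsupp.weight_apply, Finsupp.sum_fintype _ _ (by simp), Fintype.sum_sum_type] at h
  subst h
  simp [Prod.fst_sum, Prod.snd_sum]

/-- Values in a general algebra are needed: besides `K`, the scaling rule is applied in the quotient
by the ideal of minors. -/
theorem IsBihomogeneous.aeval_smul {A : Type*} [CommRing A] [Algebra K A]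
    {p : MvPolynomial (Fin (m + 1) ⊕ Fin (n + 1)) K} {ab : ℕ × ℕ} (hp : IsBihomogeneous p ab)
    (c : A) (u : Fin (m + 1) → A) (v : Fin (n + 1) → A) :
    aeval (Sum.elim u (c • v)) p = c ^ ab.2 * aeval (Sum.elim u v) p := by
  rw [aeval_def, aeval_def, eval₂_eq', eval₂_eq', Finset.mul_sum]
  refine Finset.sum_congr rfl fun s hs => ?_
  simp only [Fintype.prod_sum_type, Sum.elim_inl, Sum.elim_inr, Pi.smul_apply, smul_eq_mul,
    mul_pow, Finset.prod_mul_distrib, Finset.prod_pow_eq_pow_sum, (hp.sum_eq hs).2]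
  ring

theorem IsBihomogeneous.eval_smul {p : MvPolynomial (Fin (m + 1) ⊕ Fin (n + 1)) K} {ab : ℕ × ℕ}
    (hp : IsBihomogeneous p ab) (c : K) (u : Fin (m + 1) → K) (v : Fin (n + 1) → K) :
    eval (Sum.elim u (c • v)) p = c ^ ab.2 * eval (Sum.elim u v) p := by
  simpa [aeval_eq_eval] using hp.aeval_smul c u v

theorem IsBihomogeneous.isHomogeneous_aeval {p : MvPolynomial (Fin (m + 1) ⊕ Fin (n + 1)) K}
    {ab : ℕ × ℕ} (hp : IsBihomogeneous p ab) {e : ℕ}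
    {G : Fin (n + 1) → MvPolynomial (Fin (m + 1)) K} (hG : ∀ i, (G i).IsHomogeneous e) :
    (aeval (Sum.elim X G) p).IsHomogeneous (ab.1 + e * ab.2) := by
  rw [aeval_def, eval₂_eq']
  refine IsHomogeneous.sum _ _ _ fun s hs => ?_
  obtain ⟨h1, h2⟩ := hp.sum_eq hs
  simp only [Fintype.prod_sum_type, Sum.elim_inl, Sum.elim_inr, algebraMap_eq]
  rw [← zero_add (ab.1 + e * ab.2)]
  refine (isHomogeneous_C _ _).mul (IsHomogeneous.mul ?_ ?_)
  · rw [← h1]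
    refine IsHomogeneous.prod _ _ _ fun i _ => ?_
    simpa using (isHomogeneous_X K i).pow (s (Sum.inl i))
  · rw [← h2, Finset.mul_sum]
    exact IsHomogeneous.prod _ _ _ fun i _ => (hG i).pow (s (Sum.inr i))

theorem eval_aeval_sumElim (p : MvPolynomial (Fin (m + 1) ⊕ Fin (n + 1)) K)
    (G : Fin (n + 1) → MvPolynomial (Fin (m + 1)) K) (v : Fin (m + 1) → K) :
    eval v (aeval (Sum.elim X G) p) = eval (Sum.elim v fun i => eval v (G i)) p := by
  have h : (eval v).comp (aeval (R := K) (Sum.elim X G)).toRingHom =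
      eval (Sum.elim v fun i => eval v (G i)) := by
    apply MvPolynomial.ringHom_ext
    · intro r; simp
    · rintro (i | i) <;> simp
  exact DFunLike.congr_fun h p

theorem polyMap_rep {f : Fin (n + 1) → MvPolynomial (Fin (m + 1)) K} {t : Proj K m}
    (ht : t ∉ zeroLocus (Set.range f)) :
    ∃ c : K, c ≠ 0 ∧ (polyMap f t).rep = c • fun i => eval t.rep (f i) := by
  have h := ne_zero_of_notMem ht
  obtain ⟨a, ha⟩ := Projectivization.exists_smul_eq_mk_rep K _ h
  refine ⟨a, a.ne_zero, ?_⟩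
  rw [polyMap, dif_pos h, ← ha]
  rfl

theorem exists_eval_ne_zero {f : Fin (n + 1) → MvPolynomial (Fin (m + 1)) K}
    {t : Proj K m} (ht : t ∉ zeroLocus (Set.range f)) : ∃ i, eval t.rep (f i) ≠ 0 :=
  Function.ne_iff.mp (ne_zero_of_notMem ht)

/-! ### Extending vanishing to the whole domain of definition -/

/-- Locally on its domain, a partial morphism is given by forms of the same degree. -/
theorem PartialMorphism.exists_forms {X' : Set (Proj K m)} {Y : Set (Proj K n)}
    (s : PartialMorphism X' Y) {t₀ : Proj K m} (ht₀ : t₀ ∈ s.dom) :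
    ∃ W : Set (Proj K m), IsOpen W ∧ t₀ ∈ W ∧ X' ∩ W ⊆ s.dom ∧
      ∃ (e : ℕ) (G : Fin (n + 1) → MvPolynomial (Fin (m + 1)) K), (∀ i, (G i).IsHomogeneous e) ∧
        ∀ q ∈ X' ∩ W, ∃ c : K, c ≠ 0 ∧ (s.toFun q).rep = c • fun i => eval q.rep (G i) := by
  obtain ⟨W₀, hW₀, hdom⟩ := s.exists_open
  obtain ⟨j, hj⟩ := Function.ne_iff.mp (s.toFun t₀).rep_nonzero
  have hXj : (X j : MvPolynomial (Fin (n + 1)) K).IsHomogeneous 1 := isHomogeneous_X K j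
  set V : Set (Proj K n) := (zeroLocus {(X j : MvPolynomial (Fin (n + 1)) K)})ᶜ with hV
  have hmemV : ∀ y : Proj K n, y ∈ V ↔ y.rep j ≠ 0 := fun y => by
    rw [hV, Set.mem_compl_iff, mem_zeroLocus_singleton hXj, eval_X]
  have hVo : IsOpen V := (isClosed_zeroLocus _).isOpen_compl
  obtain ⟨W₁, hW₁, hpre⟩ := continuousOn_iff'.mp s.isMorphism.continuousOn V hVo
  -- On the chart `y_j ≠ 0` the ratios `y_i / y_j` are regular, so their pullbacks are locally
  -- quotients `g i / h i` of forms.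
  have hreg : ∀ i, IsRegularOn (s.dom ∩ s.toFun ⁻¹' (Y ∩ V))
      ((fun y : Proj K n => y.rep i / y.rep j) ∘ s.toFun) := fun i =>
    s.isMorphism.regular_comp V hVo _ fun y _ =>
      ⟨Set.univ, isOpen_univ, trivial, 1, X i, X j, isHomogeneous_X K i, hXj, fun q hq =>
        ⟨by simpa using (hmemV q).mp hq.1.2, by simp⟩⟩
  have hmem : t₀ ∈ s.dom ∩ s.toFun ⁻¹' (Y ∩ V) :=
    ⟨ht₀, s.isMorphism.mapsTo ht₀, (hmemV _).mpr hj⟩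
  choose W hW htW e g h hg hh hgh using fun i => hreg i t₀ hmem
  have htW₁ : t₀ ∈ s.toFun ⁻¹' V ∩ s.dom := ⟨hmem.2.2, ht₀⟩
  rw [hpre] at htW₁
  have hsub : X' ∩ (W₀ ∩ W₁ ∩ ⋂ i, W i) ⊆ s.dom := fun q hq => by
    rw [hdom]; exact ⟨hq.1, hq.2.1.1⟩
  -- Clearing the common denominator `∏ k, h k` turns the quotients `g i / h i` into forms of one
  -- degree `∑ k, e k`.
  refine ⟨W₀ ∩ W₁ ∩ ⋂ i, W i, (hW₀.inter hW₁).inter (isOpen_iInter_of_finite hW),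
    ⟨⟨(hdom ▸ ht₀ : t₀ ∈ X' ∩ W₀).2, htW₁.1⟩, Set.mem_iInter.mpr htW⟩, hsub,
    ∑ k, e k, fun i => g i * ∏ k ∈ Finset.univ.erase i, h k, fun i => ?_, fun q hq => ?_⟩
  · rw [← Finset.add_sum_erase _ e (Finset.mem_univ i)]
    exact (hg i).mul (IsHomogeneous.prod _ _ _ fun k _ => hh k)
  · have hqd : q ∈ s.dom := hsub hq
    have hqV : q ∈ s.toFun ⁻¹' V ∩ s.dom := by rw [hpre]; exact ⟨hq.2.1.2, hqd⟩
    have hqi : ∀ i, eval q.rep (h i) ≠ 0 ∧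
        (s.toFun q).rep i / (s.toFun q).rep j = eval q.rep (g i) / eval q.rep (h i) := fun i =>
      hgh i q ⟨⟨hqd, s.isMorphism.mapsTo hqd, hqV.1⟩, Set.mem_iInter.mp hq.2.2 i⟩
    have hj0 := (hmemV _).mp hqV.1
    have hH : ∏ k, eval q.rep (h k) ≠ 0 := Finset.prod_ne_zero_iff.mpr fun k _ => (hqi k).1
    refine ⟨(s.toFun q).rep j / ∏ k, eval q.rep (h k), div_ne_zero hj0 hH, funext fun i => ?_⟩
    have h2 := (hqi i).2
    rw [div_eq_div_iff hj0 (hqi i).1] at h2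
    rw [Pi.smul_apply, smul_eq_mul, div_mul_eq_mul_div, eq_div_iff hH, map_mul, map_prod,
      ← Finset.mul_prod_erase _ _ (Finset.mem_univ i)]
    linear_combination (∏ k ∈ Finset.univ.erase i, eval q.rep (h k)) * h2

/-- A bihomogeneous polynomial that vanishes on the graph over a non-empty open subset vanishes on
the graph of every equivalent partial morphism. -/
theorem PartialMorphism.eval_eq_zero_of_agree {X' : Set (Proj K m)} {Y : Set (Proj K n)}
    (hX : IsIrreducible X') (s r : PartialMorphism X' Y) (hrs : r.Equivalent s)
    {p : MvPolynomial (Fin (m + 1) ⊕ Fin (n + 1)) K} {ab : ℕ × ℕ} (hp : IsBihomogeneous p ab)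
    (hr : ∀ t ∈ r.dom, eval (Sum.elim t.rep (r.toFun t).rep) p = 0) {t₀ : Proj K m}
    (ht₀ : t₀ ∈ s.dom) : eval (Sum.elim t₀.rep (s.toFun t₀).rep) p = 0 := by
  obtain ⟨W, hW, htW, hsub, e, G, hG, hs⟩ := s.exists_forms ht₀
  have hP := hp.isHomogeneous_aeval hG
  have hXt₀ : t₀ ∈ X' := by
    obtain ⟨W₀, -, hdom⟩ := s.exists_open
    exact (hdom ▸ ht₀ : t₀ ∈ X' ∩ W₀).1
  have key : ∀ q ∈ X' ∩ W, eval (Sum.elim q.rep (s.toFun q).rep) p = 0 ↔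
      q ∈ zeroLocus {aeval (Sum.elim X G) p} := fun q hq => by
    obtain ⟨c, hc, hrep⟩ := hs q hq
    rw [hrep, hp.eval_smul, mem_zeroLocus_singleton hP, eval_aeval_sumElim,
      mul_eq_zero_iff_left (pow_ne_zero _ hc)]
  by_contra hcon
  rw [key t₀ ⟨hXt₀, htW⟩] at hcon
  obtain ⟨V, hV, hdom⟩ := r.exists_open
  -- If `p` failed to vanish over `t₀`, it would fail on a non-empty open subset of `X`, which meets
  -- `r.dom` by irreducibility.
  obtain ⟨q, hqX, ⟨hqW, hqP⟩, hqV⟩ := hX.2 (W ∩ (zeroLocus {aeval (Sum.elim X G) p})ᶜ) V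
    (hW.inter (isClosed_zeroLocus _).isOpen_compl) hV ⟨t₀, hXt₀, htW, hcon⟩
    (hdom ▸ r.nonempty)
  have hqr : q ∈ r.dom := by rw [hdom]; exact ⟨hqX, hqV⟩
  refine hqP ((key q ⟨hqX, hqW⟩).mp ?_)
  rw [← hrs q ⟨hqr, hsub ⟨hqX, hqW⟩⟩]
  exact hr q hqr

/-! ### The Nullstellensatz and membership in the graph ideal -/

/-- Projective Nullstellensatz for a prime ideal and a form. -/
theorem mem_of_forall_eval_eq_zero [IsAlgClosed K] {I : Ideal (MvPolynomial (Fin (m + 1)) K)}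
    [I.IsPrime] (hX : (zeroLocus (I : Set (MvPolynomial (Fin (m + 1)) K))).Nonempty)
    {q : MvPolynomial (Fin (m + 1)) K} {D : ℕ} (hq : q.IsHomogeneous D)
    (h : ∀ t ∈ zeroLocus (I : Set (MvPolynomial (Fin (m + 1)) K)), eval t.rep q = 0) :
    q ∈ I := by
  rw [← IsPrime.vanishingIdeal_zeroLocus (K := K) I, mem_vanishingIdeal_iff]
  intro v hv
  rw [aeval_eq_eval]
  have hv' : ∀ p ∈ I, eval v p = 0 := hv
  change eval v q = 0
  -- The origin is not a projective point. There `q(0) = 0 ^ D * q(t) = 0` for any `t ∈ X`;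
  -- non-emptiness of `X` is what excludes nonzero constants (`D = 0`).
  by_cases hv0 : v = 0
  · obtain ⟨t, ht⟩ := hX
    have h0 := RatMap.eval_smul hq 0 t.rep
    rw [h t ht, mul_zero, zero_smul] at h0
    rw [hv0, h0]
  · obtain ⟨a, ha⟩ := Projectivization.exists_smul_eq_mk_rep K v hv0
    have ha' : (Projectivization.mk K v hv0).rep = (a : K) • v := ha.symm
    have h1 := h (Projectivization.mk K v hv0) fun p hp e he => by
      rw [ha', RatMap.eval_smul he, hv' p hp, mul_zero]
    rw [ha', RatMap.eval_smul hq] at h1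
    exact (mul_eq_zero.mp h1).resolve_left (pow_ne_zero _ a.ne_zero)

theorem graphIdeal_eval_eq_zero {I : Ideal (MvPolynomial (Fin (m + 1)) K)}
    (hI : IsHomogeneousIdeal I) {f : Fin (n + 1) → MvPolynomial (Fin (m + 1)) K} {t : Proj K m}
    (ht : t ∈ zeroLocus (I : Set (MvPolynomial (Fin (m + 1)) K)))
    (htf : t ∉ zeroLocus (Set.range f)) {p : MvPolynomial (Fin (m + 1) ⊕ Fin (n + 1)) K}
    (hp : p ∈ graphIdeal I f) : eval (Sum.elim t.rep (polyMap f t).rep) p = 0 := by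
  obtain ⟨N, hN⟩ := hp
  obtain ⟨i, hi⟩ := exists_eval_ne_zero htf
  obtain ⟨c, -, hc⟩ := polyMap_rep htf
  have hincl : ∀ q, eval (Sum.elim t.rep (polyMap f t).rep) (inclT K m n q) = eval t.rep q :=
    fun q => by rw [inclT, eval_rename]; rfl
  have hle : I.map (inclT K m n) + minors₂ (graphMatrix f) ≤
      RingHom.ker (eval (Sum.elim t.rep (polyMap f t).rep)) := by
    refine sup_le (Ideal.map_le_iff_le_comap.mpr fun q hq => ?_) (Ideal.span_le.mpr ?_)
    · rw [Ideal.mem_comap, RingHom.mem_ker, hincl]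
      exact eval_eq_zero_of_mem_zeroLocus hI ht hq
    · rintro _ ⟨k, rfl⟩
      rw [SetLike.mem_coe, RingHom.mem_ker]
      beta_reduce
      rw [Matrix.det_fin_two]
      simp only [graphMatrix, Matrix.submatrix_apply, id_eq, Matrix.of_apply, Matrix.cons_val_zero,
        Matrix.cons_val_one, map_sub, map_mul, eval_X, Sum.elim_inr, hincl]
      rw [hc]
      simp only [Pi.smul_apply, smul_eq_mul]
      ring
  -- Some `f i` is nonzero at `t`, so its power can be cancelled.
  have h := hle (hN _ (Ideal.subset_span ⟨i, rfl⟩))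
  rw [RingHom.mem_ker, map_mul, map_pow, hincl] at h
  exact (mul_eq_zero.mp h).resolve_right (pow_ne_zero _ hi)

/-- In the quotient by the minors the vectors `f_i • x` and `x_i • f` coincide; substituting either
into `p` and extracting the scalar gives the two terms. -/
theorem pow_mul_sub_mem_minors {p : MvPolynomial (Fin (m + 1) ⊕ Fin (n + 1)) K} {ab : ℕ × ℕ}
    (hp : IsBihomogeneous p ab) (f : Fin (n + 1) → MvPolynomial (Fin (m + 1)) K)
    (i : Fin (n + 1)) :
    inclT K m n (f i) ^ ab.2 * p -
      X (Sum.inr i) ^ ab.2 * inclT K m n (aeval (Sum.elim X f) p) ∈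
        minors₂ (graphMatrix f) := by
  set J : Ideal (MvPolynomial (Fin (m + 1) ⊕ Fin (n + 1)) K) := minors₂ (graphMatrix f)
  let π := Ideal.Quotient.mkₐ K J
  have hπ : ∀ q, aeval (Sum.elim (fun k => π (X (Sum.inl k))) fun k => π (X (Sum.inr k))) q = π q := by
    intro q
    have : aeval (Sum.elim (fun k => π (X (Sum.inl k))) fun k => π (X (Sum.inr k))) = π := by
      apply MvPolynomial.algHom_ext
      rintro (k | k) <;> simp
    rw [this]
  have hπf : ∀ q, aeval (Sum.elim (fun k => π (X (Sum.inl k))) fun k => π (inclT K m n (f k))) q =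
      π (inclT K m n (aeval (R := K) (Sum.elim X f) q)) := by
    intro q
    have : aeval (Sum.elim (fun k => π (X (Sum.inl k))) fun k => π (inclT K m n (f k))) =
        (π.comp (inclT K m n)).comp (aeval (R := K) (Sum.elim X f)) := by
      apply MvPolynomial.algHom_ext
      rintro (k | k) <;> simp [inclT]
    rw [this]
    rfl
  have hsw : (π (inclT K m n (f i)) • fun k => π (X (Sum.inr k))) =
      π (X (Sum.inr i)) • fun k => π (inclT K m n (f k)) := by
    funext k
    have hk : X (Sum.inr i) * inclT K m n (f k) - X (Sum.inr k) * inclT K m n (f i) ∈ J := by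
      refine Ideal.subset_span ⟨![i, k], ?_⟩
      simp [Matrix.det_fin_two, graphMatrix]
    have := Ideal.Quotient.eq.mpr hk
    rw [Pi.smul_apply, Pi.smul_apply, smul_eq_mul, smul_eq_mul, ← map_mul, ← map_mul,
      mul_comm (inclT K m n (f i))]
    exact this.symm
  rw [← Ideal.Quotient.eq]
  change π _ = π _
  rw [map_mul, map_pow, map_mul, map_pow, ← hπ p, ← hπf, ← hp.aeval_smul, ← hp.aeval_smul, hsw]

/-- The saturation asks for one exponent valid on the whole ideal. The span lies in the radical of
`A.colon {p}` and is finitely generated, so some power of it lies in the colon ideal itself. -/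
theorem mem_saturation_of_forall_generator {R : Type*} [CommRing R] {A : Ideal R} {ι : Type*}
    [Finite ι] {g : ι → R} {p : R} (h : ∀ i, ∃ N : ℕ, p * g i ^ N ∈ A) :
    p ∈ saturation A (Ideal.span (Set.range g)) := by
  have hle : Ideal.span (Set.range g) ≤ (A.colon {p}).radical := by
    rw [Ideal.span_le]
    rintro _ ⟨i, rfl⟩
    obtain ⟨N, hN⟩ := h i
    exact ⟨N, Submodule.mem_colon_singleton.mpr (by rwa [smul_eq_mul, mul_comm])⟩
  obtain ⟨N, hN⟩ := Ideal.exists_pow_le_of_le_radical_of_fg hle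
    (Submodule.fg_span (Set.finite_range g))
  refine ⟨N, fun x hx => ?_⟩
  have := Submodule.mem_colon_singleton.mp (hN (Ideal.pow_mem_pow hx N))
  rwa [smul_eq_mul, mul_comm] at this

theorem mem_graphIdeal [IsAlgClosed K] {I : Ideal (MvPolynomial (Fin (m + 1)) K)} [I.IsPrime]
    (hX : (zeroLocus (I : Set (MvPolynomial (Fin (m + 1)) K))).Nonempty)
    {f : Fin (n + 1) → MvPolynomial (Fin (m + 1)) K} {d : ℕ} (hf : ∀ i, (f i).IsHomogeneous d)
    {p : MvPolynomial (Fin (m + 1) ⊕ Fin (n + 1)) K} {ab : ℕ × ℕ} (hp : IsBihomogeneous p ab)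
    (h : ∀ t ∈ zeroLocus (I : Set (MvPolynomial (Fin (m + 1)) K)), t ∉ zeroLocus (Set.range f) →
      eval (Sum.elim t.rep (polyMap f t).rep) p = 0) :
    p ∈ graphIdeal I f := by
  -- The exponent `ab.2` trades `x` for `f` modulo the minors; the extra factor `f i` forces
  -- vanishing on `V(f)`, where the hypothesis says nothing.
  refine mem_saturation_of_forall_generator fun i => ⟨ab.2 + 1, ?_⟩
  have hI : aeval (Sum.elim X f) p * f i ∈ I := by
    refine mem_of_forall_eval_eq_zero hX ((hp.isHomogeneous_aeval hf).mul (hf i)) fun t ht => ?_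
    rw [map_mul]
    by_cases htf : t ∈ zeroLocus (Set.range f)
    · rw [htf _ ⟨i, rfl⟩ d (hf i), mul_zero]
    · obtain ⟨c, hc, hrep⟩ := polyMap_rep htf
      have h1 := h t ht htf
      rw [hrep, hp.eval_smul] at h1
      rw [eval_aeval_sumElim, (mul_eq_zero.mp h1).resolve_left (pow_ne_zero _ hc), zero_mul]
  have h1 := Ideal.mem_map_of_mem (inclT K m n) hI
  have h2 := pow_mul_sub_mem_minors hp f i
  have heq : p * inclT K m n (f i) ^ (ab.2 + 1) =
      X (Sum.inr i) ^ ab.2 * inclT K m n (aeval (Sum.elim X f) p * f i) +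
        inclT K m n (f i) * (inclT K m n (f i) ^ ab.2 * p -
          X (Sum.inr i) ^ ab.2 * inclT K m n (aeval (Sum.elim X f) p)) := by
    rw [map_mul]
    ring
  rw [heq]
  exact Submodule.add_mem_sup (Ideal.mul_mem_left _ _ h1) (Ideal.mul_mem_left _ _ h2)

end

end RatMap

/-! ### Comparing the closure of the graph with the zero locus -/

theorem mainTheorem2 {K : Type*} [Field K] [IsAlgClosed K] (m n : ℕ)
    (I : Ideal (MvPolynomial (Fin (m + 1)) K))
    (hIhom : RatMap.IsHomogeneousIdeal I)
    (hIprime : I.IsPrime)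
    (hX : IsIrreducible (RatMap.zeroLocus (I : Set (MvPolynomial (Fin (m + 1)) K))))
    (Q : Ideal (MvPolynomial (Fin (n + 1)) K))
    (hQhom : RatMap.IsHomogeneousIdeal Q)
    (hY : IsIrreducible (RatMap.zeroLocus (Q : Set (MvPolynomial (Fin (n + 1)) K))))
    (f : Fin (n + 1) → MvPolynomial (Fin (m + 1)) K) (d : ℕ)
    (hf : ∀ i, (f i).IsHomogeneous d)
    (hne : (RatMap.zeroLocus (I : Set (MvPolynomial (Fin (m + 1)) K)) ∩
      (RatMap.zeroLocus (Set.range f))ᶜ).Nonempty)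
    (hfY : ∀ t ∈ RatMap.zeroLocus (I : Set (MvPolynomial (Fin (m + 1)) K)),
      t ∉ RatMap.zeroLocus (Set.range f) →
        RatMap.polyMap f t ∈ RatMap.zeroLocus (Q : Set (MvPolynomial (Fin (n + 1)) K))) :
    closure[RatMap.zariskiProd K m n] (RatMap.RationalMap.ofForms
        (RatMap.zeroLocus (I : Set (MvPolynomial (Fin (m + 1)) K)))
        (RatMap.zeroLocus (Q : Set (MvPolynomial (Fin (n + 1)) K))) f d hf hne hfY).graph =
      RatMap.biZeroLocus (RatMap.graphIdeal I f :
        Set (MvPolynomial (Fin (m + 1) ⊕ Fin (n + 1)) K)) := by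
  have hbase : ∀ t ∈ RatMap.zeroLocus (I : Set (MvPolynomial (Fin (m + 1)) K)),
      t ∉ RatMap.zeroLocus (Set.range f) → (t, RatMap.polyMap f t) ∈ (RatMap.RationalMap.ofForms
        (RatMap.zeroLocus (I : Set (MvPolynomial (Fin (m + 1)) K)))
        (RatMap.zeroLocus (Q : Set (MvPolynomial (Fin (n + 1)) K))) f d hf hne hfY).graph := by
    intro t ht htf
    have hmem : RatMap.PartialMorphism.ofForms _ _ f d hf hne hfY ∈
        (RatMap.RationalMap.ofForms _ _ f d hf hne hfY).reps := fun _ _ => rfl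
    exact ⟨⟨_, hmem, ht, htf⟩, _, hmem, ⟨ht, htf⟩, rfl⟩
  have hgraph : ∀ (p : MvPolynomial (Fin (m + 1) ⊕ Fin (n + 1)) K) (ab : ℕ × ℕ),
      RatMap.IsBihomogeneous p ab →
      (∀ t ∈ RatMap.zeroLocus (I : Set (MvPolynomial (Fin (m + 1)) K)),
        t ∉ RatMap.zeroLocus (Set.range f) →
          eval (Sum.elim t.rep (RatMap.polyMap f t).rep) p = 0) →
      ∀ z ∈ (RatMap.RationalMap.ofForms _ _ f d hf hne hfY).graph,
        eval (Sum.elim z.1.rep z.2.rep) p = 0 := by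
    rintro p ab hp h ⟨t, x⟩ ⟨-, s, hs, hts, hx⟩
    obtain rfl : x = s.toFun t := hx
    exact s.eval_eq_zero_of_agree hX (RatMap.PartialMorphism.ofForms _ _ f d hf hne hfY) hs hp
      (fun q hq => h q hq.1 hq.2) hts
  apply Set.Subset.antisymm
  · refine (@IsClosed.closure_subset_iff _ (RatMap.zariskiProd K m n) _ _
      (RatMap.isClosed_biZeroLocus _)).mpr fun z hz p hp ab hab => ?_
    exact hgraph p ab hab
      (fun t ht htf => RatMap.graphIdeal_eval_eq_zero hIhom ht htf hp) z hz
  · intro z hz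
    -- The closure is cut out by some `S`. Its bihomogeneous members vanish on the graph, so they
    -- lie in the graph ideal and vanish at `z`.
    obtain ⟨S, hS⟩ := RatMap.isClosed_iff_biZeroLocus.mp
      (@isClosed_closure _ (RatMap.zariskiProd K m n) (RatMap.RationalMap.ofForms
        (RatMap.zeroLocus (I : Set (MvPolynomial (Fin (m + 1)) K)))
        (RatMap.zeroLocus (Q : Set (MvPolynomial (Fin (n + 1)) K))) f d hf hne hfY).graph)
    rw [hS]
    intro p hp ab hab
    refine hz p (RatMap.mem_graphIdeal hX.1 hf hab fun t ht htf => ?_) ab hab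
    have hmem := @subset_closure _ (RatMap.zariskiProd K m n) _ _ (hbase t ht htf)
    rw [hS] at hmem
    exact hmem p hp ab hab
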